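/- Let $m\ge 2$ be an integer and let $P(t)\in\mathbb{C}[t]$ be a non-constant polynomial. Put $$S_m(P)=\mathbb{C}[t,u]/\langle u^m-P(t)\rangle,\qquad R_m(P)=\mathbb{C}[t^{\pm1},u]/\langle u^m-P(t)\rangle,$$ and let $\mathcal{S}_m(P)=\operatorname{Der}(S_m(P))$ and $\mathcal{R}_m(P)=\operatorname{Der}(R_m(P))$ be the Lie algebras of all $\mathbb{C}$-linear derivations of these commutative algebras, with the commutator bracket. If $\mathcal{S}_m(P)$ is a simple Lie algebra, then every derivation of the Lie algebra $\mathcal{S}_m(P)$ is inner, that is, of the form $y\mapsto[x,y]$ for some $x\in\mathcal{S}_m(P)$. Likewise, if $\mathcal{R}_m(P)$ is a simple Lie algebra, then every derivation of the Lie algebra $\mathcal{R}_m(P)$ is inner. -/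

import Mathlib

open Polynomial

/-- The algebra `S_m(P) = ℂ[t, u] / ⟨u ^ m - P(t)⟩`. Here `ℂ[t, u]` is `ℂ[t][u]`, and
`AdjoinRoot f` is the quotient of the polynomial ring by the ideal generated by `f`. -/
abbrev HyperellipticS (m : ℕ) (P : ℂ[X]) : Type :=
  AdjoinRoot (X ^ m - C P : ℂ[X][X])

/-- The algebra `R_m(P) = ℂ[t, t⁻¹, u] / ⟨u ^ m - P(t)⟩`. Here `ℂ[t, t⁻¹, u]` is the polynomial
ring in `u` over the Laurent polynomials in `t`. -/
abbrev SuperellipticR (m : ℕ) (P : ℂ[X]) : Type :=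
  AdjoinRoot (X ^ m - C (toLaurent P) : Polynomial (LaurentPolynomial ℂ))

/-- The Lie algebra `Der(S_m(P))` of `ℂ`-linear derivations of `S_m(P)`, with the commutator
bracket. -/
abbrev HyperellipticLie (m : ℕ) (P : ℂ[X]) : Type :=
  Derivation ℂ (HyperellipticS m P) (HyperellipticS m P)

/-- The Lie algebra `Der(R_m(P))` of `ℂ`-linear derivations of `R_m(P)`, with the commutator
bracket. -/
abbrev SuperellipticLie (m : ℕ) (P : ℂ[X]) : Type :=
  Derivation ℂ (SuperellipticR m P) (SuperellipticR m P)

/-- Every (`K`-linear) derivation of the Lie algebra `L` is inner, i.e. of the form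
`y ↦ ⁅x, y⁆` for some `x` in `L`. -/
def AllDerivationsInner (K L : Type*) [CommRing K] [LieRing L] [LieAlgebra K L] : Prop :=
  ∀ D : LieDerivation K L L, ∃ x : L, ∀ y : L, D y = ⁅x, y⁆

/-! Let `A` be either coordinate ring, `F = u ^ m - P`, and `Δ = F_u ∂_t - F_t ∂_u`. The submodule
`A Δ` is a nonzero Lie ideal (`exists_lie_hamiltonian_eq_smul`), so simplicity forces `Der A = A Δ`.
A `Δ`-stable ideal `I` gives a Lie ideal `I Δ`, so `I` is `0` or `A`; hence `A` is reduced and `Δ`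
has no zeros (`allDerivationsInner_of_isSimple`). A Lie derivation is now a linear map `d` on `A`
respecting `{f, g} = f Δ(g) - g Δ(f)`. At every point it sends the square of the maximal ideal into
that ideal (`eval_derivation_mul_eq_zero`). Points separate elements of `A`, so `d` is a first-order
operator, `d = h Δ + d(1)`, and the bracket forces `d(1) = -Δ(h)`: this is `ad (h Δ)`. -/

section LocalAnalysis

/-! ### Local behaviour of bracket derivations at a point -/

variable {K A : Type*} [Field K] [CharZero K] [CommRing A] [Algebra K A]

/-- Let `{f, g} = f Δ(g) - g Δ(f)`. A linear map `d` that is a derivation for this bracket maps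
the square of the maximal ideal of a point into that maximal ideal, provided `Δ` has no zeros. -/
theorem eval_derivation_mul_eq_zero (Δ : Derivation K A A)
    (hspan : Ideal.span (Set.range Δ) = ⊤) (d : A →ₗ[K] A)
    (hd : ∀ f g, d (f * Δ g - g * Δ f) =
      d f * Δ g - g * Δ (d f) + (f * Δ (d g) - d g * Δ f))
    (φ : A →ₐ[K] K) {a b : A} (ha : φ a = 0) (hb : φ b = 0) : φ (d (a * b)) = 0 := by
  set m : Ideal A := RingHom.ker φ with hm
  have mem (x : A) : x ∈ m ↔ φ x = 0 := RingHom.mem_ker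
  have hsq : ∀ p ∈ m ^ 2, φ p = 0 ∧ φ (Δ p) = 0 := by
    intro p hp
    rw [pow_two] at hp
    induction hp using Submodule.mul_induction_on' with
    | mem_mul_mem x hx y hy =>
      rw [mem] at hx hy
      simp [hx, hy]
    | add x hx y hy h1 h2 => simp [h1, h2]
  have sq_mem {x y : A} (hx : φ x = 0) (hy : φ y = 0) : x * y ∈ m ^ 2 := by
    rw [pow_two]; exact Ideal.mul_mem_mul ((mem x).2 hx) ((mem y).2 hy)
  have hbr (f g : A) : φ (d (f * Δ g - g * Δ f)) =
      φ (d f) * φ (Δ g) - φ g * φ (Δ (d f)) + (φ f * φ (Δ (d g)) - φ (d g) * φ (Δ f)) := by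
    rw [hd]; simp
  have hbr0 {p q : A} (hp : p ∈ m ^ 2) (hq : q ∈ m ^ 2) :
      φ (d (p * Δ q - q * Δ p)) = 0 := by
    rw [hbr, (hsq p hp).1, (hsq p hp).2, (hsq q hq).1, (hsq q hq).2]; ring
  have hfour {p q : A} (hp : p ∈ m ^ 2) (hq : q ∈ m ^ 2) : φ (d (p * q)) = 0 := by
    -- From `2pqc Δ(z) = {pc, qz} - {pcz, q}`, where all four entries lie in `m ^ 2`; the factors
    -- `Δ(z)` generate the unit ideal.
    have key : ∀ y ∈ Ideal.span (Set.range Δ), ∀ c, φ (d (p * q * (c * y))) = 0 := by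
      intro y hy
      induction hy using Submodule.span_induction with
      | mem x hx =>
        obtain ⟨z, rfl⟩ := hx
        intro c
        have h1 := hbr0 (p := p * c) (q := q * z) (Ideal.mul_mem_right _ _ hp)
          (Ideal.mul_mem_right _ _ hq)
        have h2 := hbr0 (p := p * c * z) (q := q)
          (Ideal.mul_mem_right _ _ (Ideal.mul_mem_right _ _ hp)) hq
        have h3 : (2 : K) • (p * q * (c * Δ z)) =
            (p * c * Δ (q * z) - q * z * Δ (p * c)) -
              (p * c * z * Δ q - q * Δ (p * c * z)) := by
          simp only [Derivation.leibniz, smul_eq_mul, two_smul]; ring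
        have h4 := congrArg (fun x => φ (d x)) h3
        simp only [map_smul, map_sub (d), map_sub φ] at h4
        simp only [map_sub] at h1 h2 h4
        rw [h1, h2] at h4
        simpa using h4
      | zero => simp
      | add x y hx hy h1 h2 =>
        intro c
        rw [mul_add, mul_add, map_add, map_add, h1, h2, add_zero]
      | smul r x hx h =>
        intro c
        rw [smul_eq_mul, ← mul_assoc c]
        exact h _
    simpa using key 1 (by rw [hspan]; trivial) 1
  obtain ⟨f, hf0, hf1⟩ : ∃ f, φ f = 0 ∧ φ (Δ f) = 1 := by
    obtain ⟨x, hx⟩ : ∃ x, φ (Δ x) ≠ 0 := by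
      by_contra! h
      have : Ideal.span (Set.range Δ) ≤ m :=
        Ideal.span_le.2 (by rintro _ ⟨x, rfl⟩; exact (mem _).2 (h x))
      rw [hspan, top_le_iff, Ideal.eq_top_iff_one, mem] at this
      simp at this
    refine ⟨(φ (Δ x))⁻¹ • (x - algebraMap K A (φ x)), ?_, ?_⟩
    · simp
    · simp [hx]
  have main (f : A) (hf0 : φ f = 0) (hf1 : φ (Δ f) = 1) {b : A} (hb : φ b = 0) :
      φ (d (f * b)) = 0 := by
    -- Under `φ ∘ d`, a factor `x` may be replaced by its value once the error term is known to
    -- vanish.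
    have split (p x : A) (h : φ (d (p * (x - algebraMap K A (φ x)))) = 0) :
        φ (d (p * x)) = φ x * φ (d p) := by
      have : p * x = p * (x - algebraMap K A (φ x)) + φ x • p := by
        rw [Algebra.smul_def]; ring
      rw [this]; simp [h]
    -- Compares `2fg Δ(a) = {f, ga} - {fa, g}`; `hfour` absorbs the error in replacing `Δ(a)` by its
    -- value. Taking `a = f` then gives `3 φ(d(fg)) = 0`.
    have hcube {g : A} (hg : g ∈ m ^ 2) {a : A} (ha : φ a = 0) :
        2 * (φ (Δ a) * φ (d (f * g))) = - φ (d (g * a)) := by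
      have h1 := hbr0 (sq_mem hf0 ha) hg
      have h2 := hbr f (g * a)
      have h3 : (2 : K) • (f * g * Δ a) =
          (f * Δ (g * a) - g * a * Δ f) - (f * a * Δ g - g * Δ (f * a)) := by
        simp only [Derivation.leibniz, smul_eq_mul, two_smul]; ring
      have h4 := congrArg (fun x => φ (d x)) h3
      have h5 : φ (d (f * g * (Δ a - algebraMap K A (φ (Δ a))))) = 0 := by
        rw [mul_comm f, mul_assoc]
        exact hfour hg (sq_mem hf0 (by simp))
      simp only [map_smul, smul_eq_mul] at h4
      rw [split _ _ h5, map_sub d, map_sub φ, h1, h2, hf0, hf1,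
        (hsq _ (Ideal.mul_mem_right a _ hg)).2] at h4
      rw [h4]; simp [ha]
    have hcube0 {g : A} (hg : g ∈ m ^ 2) {a : A} (ha : φ a = 0) : φ (d (g * a)) = 0 := by
      have h1 := hcube hg hf0
      rw [hf1, mul_comm g] at h1
      have h2 : φ (d (f * g)) = 0 := by linear_combination (1 / 3 : K) * h1
      have h3 := hcube hg ha
      rw [h2] at h3
      simpa using h3.symm
    -- Uses `{f, fa} = f ^ 2 Δ(a)`; the case `a = f` gives `2 φ(d(f ^ 2)) = 0`.
    have hquad {a : A} (ha : φ a = 0) : φ (Δ a) * φ (d (f * f)) = - φ (d (f * a)) := by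
      have h1 := hbr f (f * a)
      have h2 : f * Δ (f * a) - f * a * Δ f = f * f * Δ a := by
        simp only [Derivation.leibniz, smul_eq_mul]; ring
      rw [h2, split _ _ (hcube0 (sq_mem hf0 hf0) (by simp)), hf0, hf1,
        (hsq _ (sq_mem hf0 ha)).2] at h1
      rw [h1]; simp [hf0]
    have h1 := hquad hf0
    rw [hf1] at h1
    have h2 : φ (d (f * f)) = 0 := by linear_combination (1 / 2 : K) * h1
    have h3 := hquad hb
    rw [h2] at h3
    simpa using h3.symm
  have h1 := main f hf0 hf1 hb
  -- This is again a normalised local parameter; comparing it with `f` isolates `a * b`.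
  have h2 := main (f + (a - φ (Δ a) • f)) (by simp [hf0, ha]) (by simp [hf1]) hb
  have h3 : (f + (a - φ (Δ a) • f)) * b = f * b + (a * b - φ (Δ a) • (f * b)) := by
    simp only [add_mul, sub_mul, smul_mul_assoc]
  rw [h3] at h2
  simpa [h1] using h2

end LocalAnalysis

/-! ### From pointwise vanishing to inner derivations -/

/-- If `Der A` is generated as a module by a single derivation without zeros, and the `K`-points
of `A` separate its elements, then all derivations of the Lie algebra `Der A` are inner. -/
theorem allDerivationsInner_of_generator {K A : Type*} [Field K] [CharZero K] [CommRing A]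
    [Algebra K A] (Δ : Derivation K A A)
    (hΔ : ∀ δ : Derivation K A A, ∃ a : A, δ = a • Δ)
    (hspan : Ideal.span (Set.range Δ) = ⊤)
    (hpt : ∀ x : A, (∀ φ : A →ₐ[K] K, φ x = 0) → x = 0) :
    AllDerivationsInner K (Derivation K A A) := by
  have hzero {a : A} (h : ∀ x, a * Δ x = 0) : a = 0 := by
    have : Ideal.span (Set.range Δ) ≤ RingHom.ker (Ideal.Quotient.mk (Ideal.span {a}).annihilator) := by
      rw [Ideal.mk_ker, Ideal.span_le]
      rintro _ ⟨x, rfl⟩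
      simp only [SetLike.mem_coe, Submodule.mem_annihilator_span_singleton, smul_eq_mul]
      rw [mul_comm, h]
    rw [hspan, Ideal.mk_ker, top_le_iff, Ideal.eq_top_iff_one,
      Submodule.mem_annihilator_span_singleton] at this
    simpa using this
  have hinj {a b : A} (h : a • Δ = b • Δ) : a = b := by
    refine sub_eq_zero.1 (hzero fun x => ?_)
    have := congrArg (fun δ : Derivation K A A => δ x) h
    simp only [Derivation.smul_apply, smul_eq_mul] at this
    rw [sub_mul, this, sub_self]
  have hlie (f g : A) : ⁅f • Δ, g • Δ⁆ = (f * Δ g - g * Δ f) • Δ := by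
    ext x
    simp only [Derivation.commutator_apply, Derivation.smul_apply, Derivation.leibniz, smul_eq_mul]
    ring
  intro D
  choose d₀ hd₀ using fun f : A => hΔ (D (f • Δ))
  let d : A →ₗ[K] A :=
    { toFun := d₀
      map_add' := fun f g => hinj (by rw [← hd₀, add_smul, map_add, hd₀, hd₀, add_smul])
      map_smul' := fun r f => hinj (by
        rw [← hd₀, smul_assoc, map_smul, hd₀, RingHom.id_apply, smul_assoc]) }
  have hdD (f : A) : D (f • Δ) = d f • Δ := hd₀ f
  have hd (f g : A) : d (f * Δ g - g * Δ f) =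
      d f * Δ g - g * Δ (d f) + (f * Δ (d g) - d g * Δ f) := by
    refine hinj ?_
    rw [← hdD, ← hlie, LieDerivation.apply_lie_eq_add, hdD, hdD, hlie, hlie, add_smul, add_comm]
  have hE (f g : A) : d (f * g) - f * d g - g * d f + f * g * d 1 = 0 := by
    refine hpt _ fun φ => ?_
    have h := eval_derivation_mul_eq_zero Δ hspan d hd φ
      (a := f - algebraMap K A (φ f)) (b := g - algebraMap K A (φ g)) (by simp) (by simp)
    have h1 : (f - algebraMap K A (φ f)) * (g - algebraMap K A (φ g)) =
        f * g - φ g • f - φ f • g + (φ f * φ g) • 1 := by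
      simp only [Algebra.smul_def, map_mul]; ring
    rw [h1] at h
    simp only [map_add, map_sub, map_smul, smul_eq_mul, map_mul] at h ⊢
    linear_combination h
  let E : Derivation K A A := Derivation.mk' (d - LinearMap.mulRight K (d 1)) fun f g => by
    simp only [LinearMap.sub_apply, LinearMap.mulRight_apply, smul_eq_mul]
    linear_combination hE f g
  obtain ⟨h, hh⟩ := hΔ E
  have hd' (f : A) : d f = h * Δ f + f * d 1 := by
    have h1 : E f = d f - f * d 1 := rfl
    have h2 : E f = h * Δ f := by rw [hh, Derivation.smul_apply, smul_eq_mul]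
    linear_combination h2 - h1
  -- Apply the bracket identity to `{1, g} = Δ(g)`.
  have hs : d 1 + Δ h = 0 := by
    refine hzero fun g => ?_
    have := hd 1 g
    simp only [one_mul, Derivation.map_one_eq_zero, mul_zero, sub_zero] at this
    rw [hd' (Δ g), hd' g] at this
    simp only [map_add, Derivation.leibniz, smul_eq_mul] at this
    linear_combination -this
  refine ⟨h • Δ, fun y => ?_⟩
  obtain ⟨f, rfl⟩ := hΔ y
  rw [hdD, hlie, hd']
  congr 1
  linear_combination f * hs

/-! ### Consequences of simplicity -/

/-- The `K`-points of a reduced algebra of finite type separate its elements. -/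
theorem eq_zero_of_forall_algHom_eq_zero {K A : Type*} [Field K] [IsAlgClosed K] [CommRing A]
    [Algebra K A] [Algebra.FiniteType K A] [IsReduced A] (x : A)
    (h : ∀ φ : A →ₐ[K] K, φ x = 0) : x = 0 := by
  have : IsJacobsonRing A := isJacobsonRing_of_finiteType (A := K)
  have hjac : (⊥ : Ideal A).jacobson = ⊥ :=
    IsJacobsonRing.out inferInstance (Ideal.isRadical_bot)
  rw [← Ideal.mem_bot, ← hjac, Ideal.jacobson, Ideal.mem_sInf]
  rintro M ⟨-, hM⟩
  let := Ideal.Quotient.field M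
  have : Module.Finite K (A ⧸ M) := finite_of_finite_type_of_isJacobsonRing K (A ⧸ M)
  let e : K ≃ₐ[K] A ⧸ M := AlgEquiv.ofBijective (Algebra.ofId K (A ⧸ M))
    (IsAlgClosed.algebraMap_bijective_of_isIntegral (k := K) (K := A ⧸ M))
  have := h (e.symm.toAlgHom.comp (Ideal.Quotient.mkₐ K M))
  rw [← Ideal.Quotient.eq_zero_iff_mem]
  exact e.symm.injective (by simpa using this)

/-- In characteristic zero a derivation preserves nilpotent elements. -/
theorem IsNilpotent.derivation {K A : Type*} [Field K] [CharZero K] [CommRing A] [Algebra K A]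
    (Δ : Derivation K A A) {x : A} (hx : IsNilpotent x) : IsNilpotent (Δ x) := by
  have key : ∀ k j : ℕ, x ^ k * Δ x ^ j = 0 → IsNilpotent (Δ x) := by
    intro k
    induction k with
    | zero => exact fun j hj => ⟨j, by simpa using hj⟩
    | succ k ih =>
      intro j hj
      -- Differentiating lowers the power of `x` and adds one factor `Δ x`. The second extra factor
      -- restores the one lost in `Δ((Δ x) ^ j)`, so that term dies by `hj`.
      refine ih (j + 2) ?_
      have h1 := congrArg (fun y => Δ x * Δ y) hj
      have h2 : Δ x * (j • Δ x ^ (j - 1) * Δ (Δ x)) * x ^ (k + 1) = 0 := by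
        rcases j with _ | j
        · simp
        · rw [_root_.pow_succ _ j] at hj
          simp only [Nat.add_sub_cancel, nsmul_eq_mul]
          linear_combination ((j + 1 : ℕ) : A) * Δ (Δ x) * hj
      simp only [Derivation.leibniz, Derivation.leibniz_pow, smul_eq_mul, map_zero, mul_zero,
        Nat.add_sub_cancel] at h1
      have h3 : ((k + 1 : ℕ) : K) • (x ^ k * Δ x ^ (j + 2)) = 0 := by
        rw [Nat.cast_smul_eq_nsmul]
        simp only [nsmul_eq_mul] at h1 h2 ⊢
        linear_combination h1 - h2
      exact (smul_eq_zero.1 h3).resolve_left (Nat.cast_ne_zero.2 k.succ_ne_zero)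
  obtain ⟨n, hn⟩ := hx
  exact key n 0 (by simp [hn])

/-- If `Der A` is simple and a derivation `Δ` that takes a regular value spans a Lie ideal
`A Δ`, then all derivations of `Der A` are inner. -/
theorem allDerivationsInner_of_isSimple {K A : Type*} [Field K] [CharZero K] [IsAlgClosed K]
    [CommRing A] [Algebra K A] [Algebra.FiniteType K A]
    (hsimple : LieAlgebra.IsSimple K (Derivation K A A)) (Δ : Derivation K A A)
    (t : A) (ht : ∀ x, x * Δ t = 0 → x = 0)
    (hideal : ∀ δ : Derivation K A A, ∃ e : A, ⁅δ, Δ⁆ = e • Δ) :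
    AllDerivationsInner K (Derivation K A A) := by
  have : Nontrivial A := by
    by_contra h
    rw [not_nontrivial_iff_subsingleton] at h
    exact hsimple.non_abelian ⟨fun x y => by ext a; exact Subsingleton.elim _ _⟩
  have hinj {a b : A} (h : a • Δ = b • Δ) : a = b := by
    have := congrArg (fun δ : Derivation K A A => δ t) h
    simp only [Derivation.smul_apply, smul_eq_mul] at this
    exact sub_eq_zero.1 (ht _ (by rw [sub_mul, this, sub_self]))
  have dichotomy (I : Ideal A) (hI : ∀ δ : Derivation K A A, ∀ x ∈ I, ∃ y ∈ I, ⁅δ, x • Δ⁆ = y • Δ) :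
      (∀ x ∈ I, x = 0) ∨ ∀ δ : Derivation K A A, ∃ x ∈ I, δ = x • Δ := by
    let N : LieIdeal K (Derivation K A A) :=
      { carrier := {δ | ∃ x ∈ I, δ = x • Δ}
        add_mem' := by
          rintro _ _ ⟨x, hx, rfl⟩ ⟨y, hy, rfl⟩
          exact ⟨x + y, I.add_mem hx hy, (add_smul _ _ _).symm⟩
        zero_mem' := ⟨0, I.zero_mem, (zero_smul _ _).symm⟩
        smul_mem' := by
          rintro r _ ⟨x, hx, rfl⟩
          exact ⟨r • x, Submodule.smul_of_tower_mem I r hx, (smul_assoc _ _ _).symm⟩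
        lie_mem := by
          rintro δ _ ⟨x, hx, rfl⟩
          exact hI δ x hx }
    rcases hsimple.eq_bot_or_eq_top N with h | h
    · left
      intro x hx
      have : x • Δ ∈ N := ⟨x, hx, rfl⟩
      rw [h, LieSubmodule.mem_bot] at this
      exact hinj (by rw [this, zero_smul])
    · right
      intro δ
      have : δ ∈ N := by rw [h]; trivial
      exact this
  have hlie (δ : Derivation K A A) (x e : A) (h : ⁅δ, Δ⁆ = e • Δ) :
      ⁅δ, x • Δ⁆ = (δ x + x * e) • Δ := by
    ext y
    have h' := congrArg (fun δ : Derivation K A A => δ y) h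
    simp only [Derivation.commutator_apply, Derivation.smul_apply, Derivation.leibniz,
      smul_eq_mul] at h' ⊢
    linear_combination x * h'
  have hgen (δ : Derivation K A A) : ∃ a : A, δ = a • Δ := by
    rcases dichotomy ⊤ fun δ x _ => by
      obtain ⟨e, he⟩ := hideal δ
      exact ⟨_, trivial, hlie δ x e he⟩ with h | h
    · exact absurd (h 1 trivial) one_ne_zero
    · obtain ⟨x, -, hx⟩ := h δ
      exact ⟨x, hx⟩
  have stable (I : Ideal A) (hI : ∀ x ∈ I, Δ x ∈ I) : (∀ x ∈ I, x = 0) ∨ I = ⊤ := by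
    refine (dichotomy I fun δ x hx => ?_).imp_right fun h => ?_
    · obtain ⟨a, rfl⟩ := hgen δ
      obtain ⟨e, he⟩ := hideal (a • Δ)
      exact ⟨_, I.add_mem (I.mul_mem_left a (hI x hx)) (I.mul_mem_right e hx), hlie _ x e he⟩
    · obtain ⟨x, hx, h⟩ := h Δ
      rw [Ideal.eq_top_iff_one]
      rwa [hinj ((one_smul A Δ).trans h)]
  have : IsReduced A := by
    refine ⟨fun x hx => ?_⟩
    rcases stable (nilradical A) fun x hx => IsNilpotent.derivation Δ hx with h | h
    · exact h x hx
    · exact absurd (mem_nilradical.1 ((Ideal.eq_top_iff_one _).1 h)) not_isNilpotent_one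
  refine allDerivationsInner_of_generator Δ hgen ?_ eq_zero_of_forall_algHom_eq_zero
  refine (stable (Ideal.span (Set.range Δ)) fun x _ => Ideal.subset_span ⟨x, rfl⟩).resolve_left fun h => one_ne_zero (α := A) ?_
  exact ht 1 (by rw [one_mul]; exact h _ (Ideal.subset_span ⟨t, rfl⟩))

/-! ### Hamiltonian derivations of plane curves -/

section PlaneCurve

variable {K G A : Type*} [CommRing K] [CommRing G] [CommRing A] [Algebra K G] [Algebra K A]

/-- The Hamiltonian derivation `F₂ ∂₁ - F₁ ∂₂` of the quotient of `G` by `F`. -/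
theorem exists_hamiltonian_derivation (D₁ D₂ : Derivation K G G) (F : G)
    (π : G →ₐ[K] A) (hπ : Function.Surjective π) (hker : ∀ g, π g = 0 ↔ F ∣ g) :
    ∃ Δ : Derivation K A A, ∀ g, Δ (π g) = π (D₂ F * D₁ g - D₁ F * D₂ g) := by
  have h : ∀ g, π g = 0 → π ((D₂ F • D₁ - D₁ F • D₂) g) = 0 := by
    intro g hg
    obtain ⟨c, rfl⟩ := (hker g).1 hg
    have hF : π F = 0 := (hker F).2 dvd_rfl
    simp only [Derivation.sub_apply, Derivation.smul_apply, Derivation.leibniz, smul_eq_mul,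
      map_sub, map_mul, map_add, hF]
    ring
  refine ⟨Derivation.liftOfSurjective hπ h, fun g => ?_⟩
  rw [Derivation.liftOfSurjective_apply]
  simp

/-- The Hamiltonian derivation of a plane curve spans a Lie ideal. -/
theorem exists_lie_hamiltonian_eq_smul (D₁ D₂ : Derivation K G G)
    (hcomm : ∀ g, D₁ (D₂ g) = D₂ (D₁ g)) (F t u : G) (ht₁ : D₁ t = 1) (ht₂ : D₂ t = 0)
    (hu₁ : D₁ u = 0) (hu₂ : D₂ u = 1)
    (π : G →ₐ[K] A) (hπ : Function.Surjective π) (hker : ∀ g, π g = 0 ↔ F ∣ g)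
    (hder : ∀ (δ : Derivation K A A) (g : G),
      δ (π g) = π (D₁ g) * δ (π t) + π (D₂ g) * δ (π u))
    (Δ : Derivation K A A) (hΔ : ∀ g, Δ (π g) = π (D₂ F * D₁ g - D₁ F * D₂ g))
    (δ : Derivation K A A) : ∃ e : A, ⁅δ, Δ⁆ = e • Δ := by
  obtain ⟨a, ha⟩ := hπ (δ (π t))
  obtain ⟨b, hb⟩ := hπ (δ (π u))
  have hF : π F = 0 := (hker F).2 dvd_rfl
  -- The lift `a ∂₁ + b ∂₂` of `δ` preserves `(F)`. Differentiating the relation modulo `F` yields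
  -- the multiplier: `c` minus the divergence of the lift.
  obtain ⟨c, hc⟩ : F ∣ D₁ F * a + D₂ F * b := by
    rw [← hker, map_add, map_mul, map_mul, ha, hb, ← hder, hF, map_zero]
  have h₁ := congrArg (fun g => π (D₁ g)) hc
  have h₂ := congrArg (fun g => π (D₂ g)) hc
  simp only [map_add, Derivation.leibniz, smul_eq_mul, map_mul, hF, hcomm] at h₁ h₂
  refine ⟨π (c - D₁ a - D₂ b), ?_⟩
  ext x
  obtain ⟨g, rfl⟩ := hπ x
  rw [hder, hder ((π (c - D₁ a - D₂ b)) • Δ)]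
  have eqt : ⁅δ, Δ⁆ (π t) = (π (c - D₁ a - D₂ b) • Δ) (π t) := by
    rw [Derivation.commutator_apply, hΔ, ← ha, hΔ, hder, ← ha, ← hb, Derivation.smul_apply, hΔ]
    simp only [ht₁, ht₂, map_sub, map_mul, mul_one, mul_zero, sub_zero, smul_eq_mul, hcomm]
    linear_combination h₂
  have equ : ⁅δ, Δ⁆ (π u) = (π (c - D₁ a - D₂ b) • Δ) (π u) := by
    rw [Derivation.commutator_apply, hΔ, ← hb, hΔ, hder, ← ha, ← hb, Derivation.smul_apply, hΔ]
    simp only [hu₁, hu₂, map_sub, map_mul, map_neg, mul_one, mul_zero, zero_sub, smul_eq_mul]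
    linear_combination -h₁
  rw [eqt, equ]

end PlaneCurve

/-! ### The superelliptic equation -/

/-- The derivation of `B[u]` acting on coefficients by a given derivation of `B`. -/
noncomputable def coeffDerivation {K B : Type*} [CommRing K] [CommRing B] [Algebra K B]
    (D : Derivation K B B) : Derivation K B[X] B[X] :=
  PolynomialModule.equivPolynomialSelf.compDer D.mapCoeffs

theorem coeff_coeffDerivation {K B : Type*} [CommRing K] [CommRing B] [Algebra K B]
    (D : Derivation K B B) (p : B[X]) (n : ℕ) : (coeffDerivation D p).coeff n = D (p.coeff n) :=
  rfl

/-- The superelliptic equation `u ^ m = Q` over a coefficient domain `B` with a coordinate `τ`. -/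
theorem allDerivationsInner_adjoinRoot {K B : Type*} [Field K] [CharZero K] [IsAlgClosed K]
    [CommRing B] [IsDomain B] [Algebra K B] [Algebra.FiniteType K B]
    (D : Derivation K B B) (τ : B) (hτ : D τ = 1) (m : ℕ) (hm : m ≠ 0) (Q : B) (hQ : Q ≠ 0)
    (hder : ∀ (φ : B →ₐ[K] AdjoinRoot (X ^ m - C Q : B[X]))
      (δ : Derivation K (AdjoinRoot (X ^ m - C Q : B[X])) (AdjoinRoot (X ^ m - C Q : B[X]))) (b : B),
      δ (φ b) = φ (D b) * δ (φ τ))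
    (hsimple : LieAlgebra.IsSimple K
      (Derivation K (AdjoinRoot (X ^ m - C Q : B[X])) (AdjoinRoot (X ^ m - C Q : B[X])))) :
    AllDerivationsInner K
      (Derivation K (AdjoinRoot (X ^ m - C Q : B[X])) (AdjoinRoot (X ^ m - C Q : B[X]))) := by
  set F : B[X] := X ^ m - C Q with hF
  have hmonic : F.Monic := monic_X_pow_sub_C Q hm
  let π : B[X] →ₐ[K] AdjoinRoot F := Ideal.Quotient.mkₐ K (Ideal.span {F})
  have hπ : Function.Surjective π := Ideal.Quotient.mkₐ_surjective K _
  have hker (g : B[X]) : π g = 0 ↔ F ∣ g := AdjoinRoot.mk_eq_zero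
  have : Algebra.FiniteType K (AdjoinRoot F) :=
    Algebra.FiniteType.of_surjective (A := B[X]) π hπ
  let D₁ := coeffDerivation D
  let D₂ : Derivation K B[X] B[X] := Polynomial.derivative'.restrictScalars K
  have hD₁C (b : B) : D₁ (C b) = C (D b) := by
    ext n
    rw [coeff_coeffDerivation, coeff_C, coeff_C]
    split_ifs <;> simp
  have hD₁X : D₁ X = 0 := by
    ext n
    rw [coeff_coeffDerivation, coeff_X]
    split_ifs <;> simp
  have hD₂C (b : B) : D₂ (C b) = 0 := derivative_C
  have hD₂X : D₂ X = 1 := derivative_X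
  have hcomm (g : B[X]) : D₁ (D₂ g) = D₂ (D₁ g) := by
    ext n
    change (coeffDerivation D (derivative g)).coeff n = (derivative (coeffDerivation D g)).coeff n
    rw [coeff_derivative, coeff_coeffDerivation, coeff_coeffDerivation, coeff_derivative]
    simp [mul_comm]
  have hderπ (δ : Derivation K (AdjoinRoot F) (AdjoinRoot F)) (g : B[X]) :
      δ (π g) = π (D₁ g) * δ (π (C τ)) + π (D₂ g) * δ (π X) := by
    induction g using Polynomial.induction_on with
    | C b =>
      rw [hD₁C, hD₂C, map_zero, zero_mul, add_zero]
      exact hder (π.comp (IsScalarTower.toAlgHom K B B[X])) δ b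
    | add p q hp hq => simp only [map_add, hp, hq]; ring
    | monomial n b ih =>
      rw [pow_succ, ← mul_assoc]
      generalize C b * X ^ n = p at ih ⊢
      simp only [Derivation.leibniz, map_mul, map_add, ih, hD₁X, hD₂X, smul_eq_mul, mul_zero,
        mul_one, zero_add]
      ring
  obtain ⟨Δ, hΔ⟩ := exists_hamiltonian_derivation D₁ D₂ F π hπ hker
  have hΔt : Δ (π (C τ)) = (m : K) • π X ^ (m - 1) := by
    have hD₂F : D₂ F = (m : B[X]) * X ^ (m - 1) := by
      rw [hF, map_sub D₂, hD₂C, Derivation.leibniz_pow, hD₂X]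
      simp
    rw [hΔ, hD₁C, hD₂C, hτ, hD₂F]
    simp [Algebra.smul_def]
  -- The quotient is free over the domain `B`, so `Q` is regular; as `u ^ m = Q`, so is `Δ(t) = m u
  -- ^ (m - 1)`.
  have hQreg (x : AdjoinRoot F) (hx : x * π (C Q) = 0) : x = 0 := by
    obtain ⟨g, rfl⟩ := hπ x
    rw [← map_mul, hker] at hx
    rw [hker, ← modByMonic_eq_zero_iff_dvd hmonic]
    rw [← modByMonic_eq_zero_iff_dvd hmonic, mul_comm, ← smul_eq_C_mul, smul_modByMonic] at hx
    exact (smul_eq_zero.1 hx).resolve_left hQ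
  have hXm : π X ^ m = π (C Q) := by
    rw [← map_pow, ← sub_eq_zero, ← map_sub, hker]
  refine allDerivationsInner_of_isSimple hsimple Δ (π (C τ)) (fun x hx => ?_)
    (exists_lie_hamiltonian_eq_smul D₁ D₂ hcomm F (C τ) X (by rw [hD₁C, hτ, C_1]) (hD₂C τ) hD₁X hD₂X
      π hπ hker hderπ Δ hΔ)
  rw [hΔt, mul_smul_comm] at hx
  have hx' := (smul_eq_zero.1 hx).resolve_left (Nat.cast_ne_zero.2 hm)
  refine hQreg x ?_
  rw [← hXm, ← Nat.succ_pred_eq_of_ne_zero hm, pow_succ, ← mul_assoc]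
  simp only [Nat.pred_eq_sub_one] at hx' ⊢
  rw [hx', zero_mul]

/-! ### Chain rule for polynomials and Laurent polynomials -/

/-- A derivation of an algebra over the polynomial ring is determined by its value at `X`. -/
theorem Polynomial.derivation_apply_algHom {K A : Type*} [CommRing K] [CommRing A] [Algebra K A]
    (φ : K[X] →ₐ[K] A) (δ : Derivation K A A) (p : K[X]) :
    δ (φ p) = φ (derivative p) * δ (φ X) := by
  have h (p : K[X]) : φ p = aeval (φ X) p := by
    rw [aeval_algHom_apply, aeval_X_left_apply]
  rw [h, Derivation.map_aeval, h (derivative p), smul_eq_mul]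

namespace LaurentPolynomial

variable {K : Type*} [CommRing K]

/-- Formal differentiation of Laurent polynomials, as a linear map. -/
noncomputable def derivativeLinear : LaurentPolynomial K →ₗ[K] LaurentPolynomial K :=
  (Finsupp.lsum K fun n : ℤ => LinearMap.toSpanSingleton K _ (n • (T (n - 1) : LaurentPolynomial K))).comp
    (AddMonoidAlgebra.coeffLinearEquiv K).toLinearMap

theorem derivativeLinear_C_mul_T (a : K) (n : ℤ) :
    derivativeLinear (C a * T n) = n • (C a * T (n - 1)) := by
  rw [← single_eq_C_mul_T]
  simp only [derivativeLinear, LinearMap.comp_apply, LinearEquiv.coe_coe]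
  erw [Finsupp.lsum_single]
  rw [LinearMap.toSpanSingleton_apply, smul_comm, smul_eq_C_mul]

/-- The derivation `d/dT` of the Laurent polynomials. -/
noncomputable def derivative :
    Derivation K (LaurentPolynomial K) (LaurentPolynomial K) :=
  Derivation.mk' derivativeLinear fun p q => by
    induction p using LaurentPolynomial.induction_on' with
    | add p p' hp hp' => simp only [add_mul, map_add, hp, hp', smul_eq_mul]; ring
    | C_mul_T n a =>
      induction q using LaurentPolynomial.induction_on' with
      | add q q' hq hq' => simp only [mul_add, map_add, hq, hq', smul_eq_mul]; ring
      | C_mul_T k b =>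
        have h : (C a * T n : LaurentPolynomial K) * (C b * T k) = C (a * b) * T (n + k) := by
          rw [map_mul, T_add]; ring
        have h1 : (T n : LaurentPolynomial K) * T (k - 1) = T (n + k - 1) := by
          rw [← T_add]; congr 1; ring
        have h2 : (T k : LaurentPolynomial K) * T (n - 1) = T (n + k - 1) := by
          rw [← T_add]; congr 1; ring
        rw [h]
        simp only [derivativeLinear_C_mul_T, smul_eq_mul, zsmul_eq_mul, Int.cast_add]
        rw [map_mul]
        linear_combination (-(k : LaurentPolynomial K)) * C a * C b * h1 - n * C a * C b * h2

theorem derivative_C_mul_T (a : K) (n : ℤ) :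
    derivative (C a * T n) = n • (C a * T (n - 1)) :=
  derivativeLinear_C_mul_T a n

/-- A derivation of an algebra over the Laurent polynomials is determined by its value at `T`. -/
theorem derivation_apply_algHom {A : Type*} [CommRing A] [Algebra K A]
    (φ : LaurentPolynomial K →ₐ[K] A) (δ : Derivation K A A) (p : LaurentPolynomial K) :
    δ (φ p) = φ (derivative p) * δ (φ (T 1)) := by
  have hC (a : K) : φ (C a) = algebraMap K A a := by
    rw [C_eq_algebraMap, AlgHom.commutes]
  -- The value on the inverse of `T` is forced by differentiating `T⁻¹ T = 1`.
  have hneg : δ (φ (T (-1))) = - φ (T (-1)) ^ 2 * δ (φ (T 1)) :=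
    δ.leibniz_of_mul_eq_one (by rw [← map_mul, ← T_add]; simp)
  have hmul (x y : LaurentPolynomial K) (hx : δ (φ x) = φ (derivative x) * δ (φ (T 1)))
      (hy : δ (φ y) = φ (derivative y) * δ (φ (T 1))) :
      δ (φ (x * y)) = φ (derivative (x * y)) * δ (φ (T 1)) := by
    rw [map_mul, Derivation.leibniz, hx, hy, derivative.leibniz]
    simp only [smul_eq_mul, map_add, map_mul]
    ring
  have hT (n : ℤ) : derivative (T n : LaurentPolynomial K) = n • T (n - 1) := by
    simpa using derivative_C_mul_T (1 : K) n
  induction p using LaurentPolynomial.induction_on with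
  | h_C a =>
    rw [hC, Derivation.map_algebraMap]
    have := derivative_C_mul_T a 0
    rw [T_zero, mul_one, zero_smul] at this
    rw [this, map_zero, zero_mul]
  | h_add hp hq => simp only [map_add, hp, hq, add_mul]
  | h_C_mul_T n a h =>
    rw [T_add, ← mul_assoc]
    exact hmul _ _ h (by rw [hT]; simp)
  | h_C_mul_T_Z n a h =>
    rw [sub_eq_add_neg, T_add, ← mul_assoc]
    refine hmul _ _ h ?_
    rw [hT, hneg, ← map_pow, T_pow]
    simp

end LaurentPolynomial

theorem theorem7 (m : ℕ) (hm : 2 ≤ m) (P : ℂ[X]) (hP : 1 ≤ P.natDegree) :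
    (LieAlgebra.IsSimple ℂ (HyperellipticLie m P) →
      AllDerivationsInner ℂ (HyperellipticLie m P)) ∧
    (LieAlgebra.IsSimple ℂ (SuperellipticLie m P) →
      AllDerivationsInner ℂ (SuperellipticLie m P)) := by
  have hP0 : P ≠ 0 := by
    rintro rfl
    simp at hP
  refine ⟨allDerivationsInner_adjoinRoot (Polynomial.derivative' : Derivation ℂ ℂ[X] ℂ[X]) X
      derivative_X m (by omega) P hP0 fun φ δ b => Polynomial.derivation_apply_algHom φ δ b,
    allDerivationsInner_adjoinRoot LaurentPolynomial.derivative (LaurentPolynomial.T 1) ?_ m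
      (by omega) (toLaurent P) (toLaurent_ne_zero.2 hP0) fun φ δ b =>
      LaurentPolynomial.derivation_apply_algHom φ δ b⟩
  simpa using LaurentPolynomial.derivative_C_mul_T (1 : ℂ) 1
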